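/- Let $p$ be a prime, let $n=p-1$, and let $G=\mathrm{GA}(1,p)=\mathbb F_p\rtimes\mathbb F_p^{*}\cong\mathbb Z_p\rtimes\mathbb Z_{p-1}$ be the general affine group of degree one over $\mathbb F_p$, where $\mathbb F_p^{*}$ acts on the additive group $\mathbb F_p$ by multiplication. An integer group determinant of $G$ is an integer of the form $D\big(\sum_{g\in G}a_g g\big)=\det\big(a_{gh^{-1}}\big)_{g,h\in G}$ with $\sum_{g\in G}a_g g\in\mathbb Z[G]$. Then for all integers $m$ and $\ell$ such that $\gcd(m,n)=1$ or $n^2\mid m$, the integer $$m\,(m+\ell p)^{p-1}$$ is an integer group determinant of $G$. -/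

import Mathlib

/-- The evaluated group determinant of an element `∑ a_g g` of the integral group ring `ℤ[G]`:
the determinant of the matrix `(a_{g h⁻¹})`, with rows indexed by `g` and columns by `h`. -/
def groupDet (G : Type*) [Group G] [Fintype G] [DecidableEq G] (a : MonoidAlgebra ℤ G) : ℤ :=
  Matrix.det (Matrix.of fun g h : G => a.coeff (g * h⁻¹))

/-- The set of all integer group determinants of a finite group `G`. -/
def integerGroupDeterminants (G : Type*) [Group G] [Fintype G] [DecidableEq G] : Set ℤ :=
  Set.range (groupDet G)

/-- The action of `𝔽_p^*` on the additive group of `𝔽_p` (written multiplicatively): the unit `u`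
acts as `x ↦ u x`. -/
def affineAction (p : ℕ) : (ZMod p)ˣ →* MulAut (Multiplicative (ZMod p)) where
  toFun u :=
    { toFun := fun x => Multiplicative.ofAdd ((u : ZMod p) * x.toAdd)
      invFun := fun x => Multiplicative.ofAdd (((u⁻¹ : (ZMod p)ˣ) : ZMod p) * x.toAdd)
      left_inv := fun x => by simp
      right_inv := fun x => by simp
      map_mul' := fun x y => by simp [mul_add] }
  map_one' := by ext x; simp
  map_mul' u v := by ext x; simp [mul_assoc]

/-- The general affine group of degree one over `𝔽_p`: the semidirect product of the additive
group of `𝔽_p` by the multiplicative group `𝔽_p^*`, acting by multiplication. For `p` prime this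
is `ℤ_p ⋊ ℤ_{p-1}`. -/
abbrev GA (p : ℕ) : Type := Multiplicative (ZMod p) ⋊[affineAction p] (ZMod p)ˣ

instance instFintypeGA (p : ℕ) [NeZero p] : Fintype (GA p) :=
  Fintype.ofEquiv (Multiplicative (ZMod p) × (ZMod p)ˣ) SemidirectProduct.equivProd.symm

/-!
The group `GA p` has a quotient `H = 𝔽_p^*`, and its remaining irreducible representation is the
augmentation representation `ρ` of dimension `n = p - 1` on the sum-zero part of the permutation
module on `𝔽_p`. Hence a group determinant of `GA p` is the product of the determinant of the
image in `ℤ[H]` and of `det ρ ^ n` (`groupDet_affine`). The factorization is carried out over `ℤ`: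
the matrix coefficients give a square integer intertwiner `T` with the regular representation, and
the character identity `[π g = 1] + tr ρ g = p [g = 1]` shows that `T` is invertible up to the
factor `p` (`groupDet_eq_mul_pow`).

It remains to find an element with first determinant `m` and second determinant `m + l p`. The
restriction of `ρ` to the stabilizer `H` of `0` is the regular representation of `H`. So with `X` a
generator of `H`, `S` the sum of the elements of `H` and `Z` the translation by `1`, both
representations send `X` to the permutation matrix `P` of a full cycle and `S` to the all-ones
matrix `J`, and differ only at `Z`: the matrix entries of `Z` sum to `n` in one and to `-1` in the
other. Since `1 - P` has corank one, determinants of its rank-one perturbations are explicit: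
`det (1 - P + u wᵀ) = (∑ u) (∑ w)` (`det_one_sub_cycle_add_vecMulVec`).

* If `m = h n ^ 2`, the element `1 - X - Z S (b + c Z)` with `b + c = -h` has first determinant
  `n * (h n)` and second determinant `p b + h`; a suitable `b` makes the latter `m + l p`.
* If `m = r + k n` is prime to `n`, the element `∑ i < r, X ^ i + k S + l S (1 - Z)` becomes a
  rank-one perturbation of `1 - X ^ r` after multiplication by `1 - X + S`, whose determinant is
  `n ^ 2` in both representations (`det_geom_sum_add`). The determinants are `m` and
  `m + l (n + 1)`.
-/

open Matrix
open scoped Kronecker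

/-! ### The regular representation and a factorization of group determinants -/

/-- The left regular representation of a group by permutation matrices. -/
def leftRegularMatrix (G : Type*) [Group G] [Fintype G] [DecidableEq G] : G →* Matrix G G ℤ where
  toFun g := Matrix.of fun x y => if x = g * y then 1 else 0
  map_one' := by
    ext x y
    simp [Matrix.one_apply]
  map_mul' g h := by
    ext x y
    simp [Matrix.mul_apply, mul_assoc]

lemma leftRegularMatrix_apply {G : Type*} [Group G] [Fintype G] [DecidableEq G] (g x y : G) :
    leftRegularMatrix G g x y = if x = g * y then 1 else 0 := rfl

lemma groupDet_eq_det_lift {G : Type*} [Group G] [Fintype G] [DecidableEq G]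
    (a : MonoidAlgebra ℤ G) :
    groupDet G a = (MonoidAlgebra.lift ℤ (Matrix G G ℤ) G (leftRegularMatrix G) a).det := by
  unfold groupDet
  congr 1
  ext x y
  rw [MonoidAlgebra.lift_apply, Finsupp.sum_fintype _ _ (by simp), Matrix.sum_apply]
  simp_rw [Matrix.smul_apply, leftRegularMatrix_apply]
  rw [Finset.sum_eq_single (x * y⁻¹)]
  · simp
  · intro k _ hk
    rw [if_neg, smul_zero]
    rintro rfl
    simp at hk
  · simp

/-- The matrix whose `g`-th column lists the indicator of `π g` and the entries of `ρ g`. It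
intertwines the regular representation of `G` with the sum of that of `K` and copies of `ρ`. -/
def coeffMatrix {G K m : Type*} [Group G] [Group K] [DecidableEq K] [Fintype m] [DecidableEq m]
    (π : G →* K) (ρ : G →* Matrix m m ℤ) : Matrix (K ⊕ m × m) G ℤ :=
  Matrix.of fun i g => Sum.elim (fun k => if k = π g then 1 else 0) (fun ij => ρ g ij.1 ij.2) i

lemma coeffMatrix_mul_lift {G K m : Type*} [Group G] [Fintype G] [DecidableEq G]
    [Group K] [Fintype K] [DecidableEq K] [Fintype m] [DecidableEq m]
    (π : G →* K) (ρ : G →* Matrix m m ℤ) (a : MonoidAlgebra ℤ G) :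
    coeffMatrix π ρ * MonoidAlgebra.lift ℤ _ G (leftRegularMatrix G) a =
      Matrix.fromBlocks (MonoidAlgebra.lift ℤ _ G ((leftRegularMatrix K).comp π) a) 0 0
        (MonoidAlgebra.lift ℤ _ G ρ a ⊗ₖ (1 : Matrix m m ℤ)) *
        coeffMatrix π ρ := by
  induction a using MonoidAlgebra.induction_linear with
  | zero => simp
  | add x y hx hy =>
    rw [map_add, Matrix.mul_add, hx, hy, ← Matrix.add_mul, Matrix.fromBlocks_add]
    simp [Matrix.add_kronecker]
  | single g r =>
    simp only [MonoidAlgebra.lift_single, MonoidHom.comp_apply]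
    have key : coeffMatrix π ρ * leftRegularMatrix G g =
        Matrix.fromBlocks (leftRegularMatrix K (π g)) 0 0
          (ρ g ⊗ₖ (1 : Matrix m m ℤ)) * coeffMatrix π ρ := by
      ext i h
      rcases i with k | ⟨i, j⟩
      · simp [Matrix.mul_apply, coeffMatrix, leftRegularMatrix_apply]
      · simp [Matrix.mul_apply, coeffMatrix, leftRegularMatrix_apply, Fintype.sum_prod_type,
          Matrix.one_apply]
    rw [Matrix.mul_smul, key, ← Matrix.smul_mul, Matrix.fromBlocks_smul]
    simp only [Matrix.smul_kronecker, smul_zero]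

/-- If the regular character of `G` is, up to scaling, the sum of that of a quotient `K` and a
multiple of the character of `ρ`, then group determinants of `G` factor accordingly. By
the hypotheses the intertwiner `coeffMatrix` is square and invertible over `ℚ`. -/
theorem groupDet_eq_mul_pow {G K m : Type*} [Group G] [Fintype G] [DecidableEq G]
    [Group K] [Fintype K] [DecidableEq K] [Fintype m] [DecidableEq m]
    (π : G →* K) (ρ : G →* Matrix m m ℤ) {c : ℤ} (hc : c ≠ 0)
    (hcard : Fintype.card G = Fintype.card K + Fintype.card m ^ 2)
    (htrace : ∀ g, (if π g = 1 then 1 else 0) + (ρ g).trace = if g = 1 then c else 0)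
    (a : MonoidAlgebra ℤ G) :
    groupDet G a = (MonoidAlgebra.lift ℤ _ G ((leftRegularMatrix K).comp π) a).det *
      (MonoidAlgebra.lift ℤ _ G ρ a).det ^ Fintype.card m := by
  have e : G ≃ K ⊕ m × m := Fintype.equivOfCardEq (by simp [hcard, sq])
  set T := coeffMatrix π ρ with hT
  -- Up to the factor `c`, the inverse of `T` pairs `ρ k` with `ρ g⁻¹` under the trace form.
  let T' : Matrix G (K ⊕ m × m) ℤ := Matrix.of fun g i =>
    Sum.elim (fun k => if k = π g then 1 else 0) (fun ij => ρ g⁻¹ ij.2 ij.1) i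
  have hTT : T' * T = c • (1 : Matrix G G ℤ) := by
    ext g k
    have h := htrace (g⁻¹ * k)
    simp only [map_mul, map_inv, inv_mul_eq_one, Matrix.trace, Matrix.diag, Matrix.mul_apply] at h
    simp only [T', hT, coeffMatrix, Matrix.mul_apply, Fintype.sum_sum_type,
      Fintype.sum_prod_type, Matrix.of_apply, Sum.elim_inl, Sum.elim_inr, Matrix.smul_apply,
      Matrix.one_apply]
    rw [Finset.sum_comm (s := (Finset.univ : Finset m))]
    simp only [smul_eq_mul, mul_ite, mul_one, mul_zero, ← h, Finset.sum_ite_eq', Finset.mem_univ,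
      if_true, eq_comm (a := π k)]
  have hdet : (T.submatrix e id).det ≠ 0 := by
    intro h0
    have h1 : T'.submatrix id e * T.submatrix e id = c • (1 : Matrix G G ℤ) := by
      rw [Matrix.submatrix_mul_equiv, hTT, Matrix.submatrix_id_id]
    have h2 := congrArg Matrix.det h1
    rw [Matrix.det_mul, h0, mul_zero, Matrix.det_smul, Matrix.det_one, mul_one] at h2
    exact pow_ne_zero _ hc h2.symm
  have hint := congrArg (fun M => (M.submatrix e id).det) (coeffMatrix_mul_lift π ρ a)
  rw [← Matrix.submatrix_mul_equiv _ _ e (Equiv.refl G) id,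
    ← Matrix.submatrix_mul_equiv _ _ e e id, Matrix.det_mul, Matrix.det_mul,
    Matrix.det_submatrix_equiv_self, mul_comm] at hint
  have := mul_right_cancel₀ hdet hint
  rw [groupDet_eq_det_lift]
  simpa [Matrix.det_kronecker] using this

/-! ### Rank-one perturbations of a cyclic permutation matrix -/

section Cyclic

variable {H : Type*} [CommGroup H] [Fintype H] [DecidableEq H]

/-- Adding a single entry to `1 - P`, where `P` is the permutation matrix of a full cycle, removes
the wrap-around entry and leaves a unitriangular matrix. -/
lemma det_one_sub_cycle_add_single (g : H) (hg : ∀ h, h ∈ Subgroup.zpowers g) :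
    (1 - leftRegularMatrix H g + Matrix.single 1 g⁻¹ 1).det = 1 := by
  have hn : orderOf g = Fintype.card H := orderOf_eq_card_of_forall_mem_zpowers hg |>.trans
    Nat.card_eq_fintype_card
  have hb : Function.Bijective (fun i : Fin (orderOf g) => g ^ (i : ℕ)) := by
    rw [Fintype.bijective_iff_injective_and_card]
    refine ⟨fun i j hij => Fin.ext ?_, by simp [hn]⟩
    exact pow_injOn_Iio_orderOf i.2 j.2 hij
  have hpos : 0 < orderOf g := orderOf_pos g
  let e := Equiv.ofBijective _ hb
  have he : ∀ i, e i = g ^ (i : ℕ) := fun _ => rfl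
  rw [← Matrix.det_submatrix_equiv_self e]
  have hwrap : ∀ i j : Fin (orderOf g), g ^ (i : ℕ) = g * g ^ (j : ℕ) → (i : ℕ) ≤ j →
      (1 = g ^ (i : ℕ) ∧ g⁻¹ = g ^ (j : ℕ)) := by
    intro i j h hij
    rw [← pow_succ', pow_inj_mod, Nat.mod_eq_of_lt i.2] at h
    have hj : (j : ℕ) + 1 = orderOf g := by
      by_contra hne
      rw [Nat.mod_eq_of_lt (by omega)] at h
      omega
    rw [hj, Nat.mod_self] at h
    refine ⟨by simp [h], ?_⟩
    rw [inv_eq_iff_mul_eq_one, ← pow_succ', hj, pow_orderOf_eq_one]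
  have hwrap' : ∀ i j : Fin (orderOf g), (1 = g ^ (i : ℕ) ∧ g⁻¹ = g ^ (j : ℕ)) →
      g ^ (i : ℕ) = g * g ^ (j : ℕ) := by
    rintro i j ⟨h1, h2⟩
    rw [← h1, ← h2, mul_inv_cancel]
  have hentry : ∀ i j : Fin (orderOf g), i ≤ j →
      ((1 - leftRegularMatrix H g + Matrix.single 1 g⁻¹ 1).submatrix e e) i j =
        if i = j then 1 else 0 := by
    intro i j hij
    simp only [Matrix.submatrix_apply, Matrix.add_apply, Matrix.sub_apply, Matrix.one_apply,
      leftRegularMatrix_apply, Matrix.single_apply, e.injective.eq_iff]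
    rw [if_congr (show e i = g * e j ↔ (1 = e i ∧ g⁻¹ = e j) from
      ⟨fun h => hwrap i j h hij, hwrap' i j⟩) rfl rfl]
    ring
  rw [Matrix.det_of_isLowerTriangular]
  · exact Finset.prod_eq_one fun i _ => by rw [hentry i i le_rfl, if_pos rfl]
  · intro i j hij
    have hij' : i < j := hij
    rw [hentry i j hij'.le, if_neg hij'.ne]

/-- The determinant of a rank-one perturbation of `1 - P`, where `P` is the permutation matrix of a
full cycle. With `B` the unitriangular matrix of `det_one_sub_cycle_add_single`, the perturbed
matrix is `B` plus a matrix of rank two, and the determinant reduces to a `2 × 2` one. -/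
theorem det_one_sub_cycle_add_vecMulVec (g : H) (hg : ∀ h, h ∈ Subgroup.zpowers g)
    (u w : H → ℤ) :
    (1 - leftRegularMatrix H g + Matrix.vecMulVec u w).det = (∑ h, u h) * ∑ h, w h := by
  set B := 1 - leftRegularMatrix H g + Matrix.single 1 g⁻¹ 1 with hB
  have hBdet : B.det = 1 := det_one_sub_cycle_add_single g hg
  have hBu : IsUnit B.det := by rw [hBdet]; exact isUnit_one
  have hB1 : B *ᵥ 1 = Pi.single 1 1 := by
    ext x
    simp [hB, Matrix.mulVec, dotProduct, Matrix.one_apply, leftRegularMatrix_apply,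
      Matrix.single_apply, Finset.sum_add_distrib, Finset.sum_sub_distrib, Pi.single_apply,
      ← inv_mul_eq_iff_eq_mul, ite_and, eq_comm (a := (1 : H))]
  have h1B : 1 ᵥ* B = Pi.single g⁻¹ 1 := by
    ext x
    simp [hB, Matrix.vecMul, dotProduct, Matrix.one_apply, leftRegularMatrix_apply,
      Matrix.single_apply, Finset.sum_add_distrib, Finset.sum_sub_distrib, Pi.single_apply,
      ite_and, eq_comm]
  have hBinv1 : B⁻¹ *ᵥ Pi.single 1 1 = 1 := by
    rw [← hB1, Matrix.mulVec_mulVec, Matrix.nonsing_inv_mul _ hBu, Matrix.one_mulVec]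
  have h1Binv : Pi.single g⁻¹ 1 ᵥ* B⁻¹ = 1 := by
    rw [← h1B, Matrix.vecMul_vecMul, Matrix.mul_nonsing_inv _ hBu, Matrix.vecMul_one]
  let U : Matrix H (Fin 2) ℤ := Matrix.of fun h i => ![u h, (Pi.single 1 1 : H → ℤ) h] i
  let V : Matrix (Fin 2) H ℤ := Matrix.of ![w, -Pi.single g⁻¹ 1]
  have hM : 1 - leftRegularMatrix H g + Matrix.vecMulVec u w = B + U * V := by
    ext x y
    simp [hB, U, V, Matrix.mul_apply, Fin.sum_univ_two, Matrix.vecMulVec_apply,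
      Matrix.single_apply, Pi.single_apply, ite_and]
    grind
  have hent : ∀ i j, (V * B⁻¹ * U) i j = (V i ᵥ* B⁻¹) ⬝ᵥ (fun h => U h j) := fun i j => rfl
  have hV1 : V 1 = -Pi.single g⁻¹ 1 := rfl
  have h10 : (V * B⁻¹ * U) 1 0 = -∑ h, u h := by
    rw [hent, hV1, Matrix.neg_vecMul, h1Binv]
    simp [U, dotProduct]
  have h11 : (V * B⁻¹ * U) 1 1 = -1 := by
    rw [hent, hV1, Matrix.neg_vecMul, h1Binv]
    simp [U, dotProduct]
  have h01 : (V * B⁻¹ * U) 0 1 = ∑ h, w h := by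
    rw [hent, ← Matrix.dotProduct_mulVec]
    have : (fun h => U h 1) = Pi.single 1 1 := by ext; simp [U]
    rw [this, hBinv1]
    simp [V, dotProduct]
  rw [hM, Matrix.det_add_mul U V hBu, hBdet, one_mul, Matrix.det_fin_two]
  simp only [Matrix.add_apply, Matrix.one_apply, h10, h11, h01]
  simp
  ring

/-- For a perturbation `M J N` with `J` the all-ones matrix, the determinant depends on `M` and `N`
only through the sums of their entries. -/
lemma det_one_sub_cycle_add_mul_ones_mul (g : H) (hg : ∀ h, h ∈ Subgroup.zpowers g)
    (M N : Matrix H H ℤ) :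
    (1 - leftRegularMatrix H g + M * Matrix.of (fun _ _ => 1) * N).det =
      (∑ i, ∑ j, M i j) * ∑ i, ∑ j, N i j := by
  have : M * Matrix.of (fun _ _ => 1) * N =
      Matrix.vecMulVec (fun i => ∑ j, M i j) (fun j => ∑ i, N i j) := by
    ext i j
    simp [Matrix.mul_apply, Matrix.vecMulVec_apply, Finset.mul_sum]
  rw [this, det_one_sub_cycle_add_vecMulVec g hg, Finset.sum_comm (f := fun j i => N i j)]

/-- Multiplying `∑ i < r, P ^ i + k J + J W` by `1 - P + J`, where `J` is the all-ones matrix, turns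
it into a rank-one perturbation of `1 - P ^ r`, which is again `1` minus a full cycle when `r` is
prime to the order. -/
theorem det_geom_sum_add (g : H) (hg : ∀ h, h ∈ Subgroup.zpowers g) (r : ℕ)
    (hr : Nat.Coprime (Fintype.card H) r) (k : ℤ) (W : Matrix H H ℤ) :
    (∑ i ∈ Finset.range r, leftRegularMatrix H g ^ i + k • Matrix.of (fun _ _ => 1) +
      Matrix.of (fun _ _ => 1) * W).det = r + k * Fintype.card H + ∑ i, ∑ j, W i j := by
  set P := leftRegularMatrix H g with hP
  set J : Matrix H H ℤ := Matrix.of (fun _ _ => 1) with hJ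
  set n := Fintype.card H with hn
  have hn0 : (n : ℤ) ≠ 0 := by simp [hn]
  have hgr : ∀ h, h ∈ Subgroup.zpowers (g ^ r) := by
    intro h
    obtain ⟨s, rfl⟩ := hg h
    have ho : orderOf g = n := orderOf_eq_card_of_forall_mem_zpowers hg |>.trans
      Nat.card_eq_fintype_card
    have : g ∈ Subgroup.zpowers (g ^ r) := by
      rw [mem_zpowers_pow_iff, ho]
      exact hr.symm
    exact Subgroup.zpow_mem _ this s
  have hPJ : P * J = J := by
    ext x y
    simp [hP, hJ, Matrix.mul_apply, leftRegularMatrix_apply, ← inv_mul_eq_iff_eq_mul]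
  have hJP : J * P = J := by
    ext x y
    simp [hP, hJ, Matrix.mul_apply, leftRegularMatrix_apply]
  have hJJ : J * J = (n : ℤ) • J := by
    ext x y
    simp [hJ, Matrix.mul_apply, hn]
  have hJPi : ∀ i : ℕ, J * P ^ i = J := by
    intro i
    induction i with
    | zero => simp
    | succ i ih => rw [pow_succ, ← mul_assoc, ih, hJP]
  have hJs : J * ∑ i ∈ Finset.range r, P ^ i = (r : ℤ) • J := by
    simp [Finset.mul_sum, hJPi]
  have hprod : (1 - P + J) * (∑ i ∈ Finset.range r, P ^ i + k • J + J * W) =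
      1 - leftRegularMatrix H (g ^ r) +
        1 * J * (((r + k * n : ℤ)) • (1 : Matrix H H ℤ) + (n : ℤ) • W) := by
    rw [map_pow, ← hP, add_mul, mul_add, mul_add, mul_neg_geom_sum, mul_add, mul_add, hJs,
      mul_smul_comm, mul_smul_comm, ← mul_assoc, ← mul_assoc, sub_mul, one_mul, hPJ, sub_self,
      hJJ, mul_add, mul_smul_comm, mul_smul_comm, mul_one, smul_mul_assoc]
    simp only [zero_mul, smul_zero, add_zero, add_smul, mul_smul]
  have hsumone : ∑ i : H, ∑ j : H, (1 : Matrix H H ℤ) i j = n := by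
    simp [Matrix.one_apply, hn]
  have h1 := congrArg Matrix.det hprod
  have h2 : (1 - P + J).det = (n : ℤ) * n := by
    have := det_one_sub_cycle_add_mul_ones_mul g hg 1 1
    rwa [one_mul, mul_one, hsumone] at this
  rw [Matrix.det_mul, h2, det_one_sub_cycle_add_mul_ones_mul _ hgr, hsumone, mul_assoc] at h1
  have h3 := mul_left_cancel₀ hn0 h1
  refine mul_left_cancel₀ hn0 (h3.trans ?_)
  have : ∑ i : H, ∑ j : H, (((r + k * n : ℤ)) • (1 : Matrix H H ℤ) + (n : ℤ) • W) i j =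
      (r + k * n : ℤ) * ∑ i : H, ∑ j : H, (1 : Matrix H H ℤ) i j +
        (n : ℤ) * ∑ i, ∑ j, W i j := by
    simp only [Matrix.add_apply, Matrix.smul_apply, smul_eq_mul, Finset.sum_add_distrib,
      Finset.mul_sum]
  rw [this, hsumone]
  ring

end Cyclic

/-! ### The augmentation representation of the affine group -/

section Affine

variable {p : ℕ} [Fact p.Prime]

/-- A sum over the units of a function vanishing at `0` is a sum over the whole field. -/
lemma sum_units_ite_eq (c : ZMod p) (F : ZMod p → ℤ) (hF : F 0 = 0) :
    ∑ k : (ZMod p)ˣ, F k * (if (k : ZMod p) = c then 1 else 0) = F c := by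
  by_cases hc : c = 0
  · subst hc
    simp [hF]
  · obtain ⟨u, rfl⟩ := (isUnit_iff_ne_zero.mpr hc)
    simp [Units.val_inj]

lemma sum_units_indicator (c : ZMod p) :
    ∑ k : (ZMod p)ˣ, (if (k : ZMod p) = c then (1 : ℤ) else 0) = if c = 0 then 0 else 1 := by
  rw [← sum_units_ite_eq c (fun c => if c = 0 then 0 else 1) (by simp)]
  simp

/-- The action of the affine group on the augmentation submodule of the permutation module on
`𝔽_p`, in the basis of the `δ_y - δ_0` with `y ≠ 0`. -/
def augmentationRep (p : ℕ) [Fact p.Prime] :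
    GA p →* Matrix (ZMod p)ˣ (ZMod p)ˣ ℤ where
  toFun g := Matrix.of fun y y' =>
    (if (y : ZMod p) = g.left.toAdd + g.right * y' then 1 else 0) -
      (if (y : ZMod p) = g.left.toAdd then 1 else 0)
  map_one' := by
    ext y y'
    simp [Matrix.one_apply, Units.val_inj]
  map_mul' g h := by
    ext y y'
    -- The row of `g` extends by zero to the point `0`, so the sum runs over all of `𝔽_p`.
    let F : ZMod p → ℤ := fun k => (if (y : ZMod p) = g.left.toAdd + g.right * k then 1 else 0) -
      (if (y : ZMod p) = g.left.toAdd then 1 else 0)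
    have hF : F 0 = 0 := by simp [F]
    have h1 := sum_units_ite_eq (h.left.toAdd + (h.right : ZMod p) * (y' : ZMod p)) F hF
    have h2 := sum_units_ite_eq h.left.toAdd F hF
    rw [Matrix.mul_apply]
    refine Eq.symm (Eq.trans (b := F (h.left.toAdd + (h.right : ZMod p) * (y' : ZMod p)) -
      F h.left.toAdd) ?_ ?_)
    · rw [← h1, ← h2, ← Finset.sum_sub_distrib]
      exact Finset.sum_congr rfl fun k _ => mul_sub (F k) _ _
    · have hl : (g * h).left.toAdd = g.left.toAdd + (g.right : ZMod p) * h.left.toAdd := rfl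
      have hr : ((g * h).right : ZMod p) = g.right * h.right := rfl
      have hlr : (g.left.toAdd + (g.right : ZMod p) * h.left.toAdd) +
          (g.right : ZMod p) * h.right * (y' : ZMod p) =
          g.left.toAdd + g.right * (h.left.toAdd + (h.right : ZMod p) * (y' : ZMod p)) := by ring
      simp only [F, Matrix.of_apply, hl, hr, hlr, sub_sub_sub_cancel_right]

lemma augmentationRep_apply (g : GA p) (y y' : (ZMod p)ˣ) :
    augmentationRep p g y y' =
      (if (y : ZMod p) = g.left.toAdd + g.right * y' then 1 else 0) -
        (if (y : ZMod p) = g.left.toAdd then 1 else 0) := rfl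

/-- The nonzero points of `𝔽_p` are a regular orbit of the subgroup fixing `0`. -/
lemma augmentationRep_inr (u : (ZMod p)ˣ) :
    augmentationRep p (SemidirectProduct.inr u) = leftRegularMatrix _ u := by
  ext y y'
  simp [augmentationRep_apply, leftRegularMatrix_apply, ← Units.val_mul, Units.val_inj]

/-- The character of the augmentation representation counts fixed points and subtracts `1`. An
affine map that is not a translation has exactly one fixed point, and a nontrivial translation has
none. -/
lemma indicator_add_trace_augmentationRep (g : GA p) :
    (if SemidirectProduct.rightHom g = 1 then 1 else 0) + (augmentationRep p g).trace =
      if g = 1 then (p : ℤ) else 0 := by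
  obtain ⟨b, u⟩ := g
  simp only [SemidirectProduct.rightHom_eq_right, Matrix.trace, Matrix.diag,
    augmentationRep_apply, Finset.sum_sub_distrib, sum_units_indicator, SemidirectProduct.ext_iff,
    SemidirectProduct.one_left, SemidirectProduct.one_right]
  by_cases hu : u = 1
  · subst hu
    by_cases hb : b = 1
    · subst hb
      have := (Fact.out : p.Prime).one_le
      simp [ZMod.card_units p, Nat.cast_sub this]
    · simp [hb]
  · have hu' : (1 : ZMod p) - u ≠ 0 := by
      rw [sub_ne_zero, ne_comm, ← Units.val_one, Ne, Units.val_inj]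
      exact hu
    have : ∀ y : (ZMod p)ˣ, (y : ZMod p) = b.toAdd + u * y ↔ (y : ZMod p) = b.toAdd / (1 - u) := by
      intro y
      rw [eq_div_iff hu']
      constructor <;> intro h <;> linear_combination h
    simp only [this, sum_units_indicator]
    simp [hu, hu']

/-- The sum of the entries detects the difference between the augmentation representation and the
regular representation of the quotient `𝔽_p^*`, where the translation acts as `1` and the sum
is `p - 1`. -/
lemma sum_augmentationRep_translation :
    ∑ i, ∑ j, augmentationRep p (SemidirectProduct.inl (Multiplicative.ofAdd 1)) i j = -1 := by
  simp only [augmentationRep_apply]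
  rw [Finset.sum_comm]
  simp only [Finset.sum_sub_distrib, sum_units_indicator]
  simp only [SemidirectProduct.left_inl, SemidirectProduct.right_inl, toAdd_ofAdd, Units.val_one,
    one_mul, one_ne_zero, if_false]
  have : ∀ j : (ZMod p)ˣ, (if (1 : ZMod p) + j = 0 then (0 : ℤ) else 1) =
      1 - if (j : ZMod p) = -1 then 1 else 0 := by
    intro j
    have : (1 : ZMod p) + j = 0 ↔ (j : ZMod p) = -1 := by
      rw [add_comm, add_eq_zero_iff_eq_neg]
    simp only [this]
    split_ifs <;> simp
  simp only [this, Finset.sum_sub_distrib, sum_units_indicator]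
  simp

/-- The regular representation of `GA p` is the sum of that of `𝔽_p^*` and of `p - 1` copies of the
augmentation representation. -/
theorem groupDet_affine (a : MonoidAlgebra ℤ (GA p)) :
    groupDet (GA p) a =
      (MonoidAlgebra.lift ℤ _ (GA p)
        ((leftRegularMatrix (ZMod p)ˣ).comp SemidirectProduct.rightHom) a).det *
      (MonoidAlgebra.lift ℤ _ (GA p) (augmentationRep p) a).det ^ (p - 1) := by
  have hp := (Fact.out : p.Prime)
  have h := groupDet_eq_mul_pow (G := GA p) SemidirectProduct.rightHom (augmentationRep p)
    (c := p) (by exact_mod_cast hp.ne_zero) ?_ indicator_add_trace_augmentationRep a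
  · rwa [ZMod.card_units] at h
  · rw [Fintype.card_congr SemidirectProduct.equivProd, Fintype.card_prod,
      Fintype.card_multiplicative, ZMod.card, ZMod.card_units]
    obtain ⟨q, rfl⟩ := Nat.exists_eq_add_of_le hp.one_le
    simp
    ring

/-- Both matrix representations in `groupDet_affine` restrict to the regular representation of
`𝔽_p^*`, so both send the sum of its elements to the all-ones matrix. -/
lemma lift_sum_inr (φ : GA p →* Matrix (ZMod p)ˣ (ZMod p)ˣ ℤ)
    (hφ : ∀ u, φ (SemidirectProduct.inr u) = leftRegularMatrix _ u) :
    MonoidAlgebra.lift ℤ _ (GA p) φ (∑ u, MonoidAlgebra.single (SemidirectProduct.inr u) 1) =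
      Matrix.of fun _ _ => 1 := by
  ext x y
  simp [hφ, Matrix.sum_apply, leftRegularMatrix_apply, ← mul_inv_eq_iff_eq_mul]

end Affine

theorem mainTheorem1 (p : ℕ) [Fact p.Prime] (m l : ℤ)
    (hm : Int.gcd m ((p : ℤ) - 1) = 1 ∨ ((p : ℤ) - 1) ^ 2 ∣ m) :
    m * (m + l * (p : ℤ)) ^ (p - 1) ∈ integerGroupDeterminants (GA p) := by
  have hp := (Fact.out : p.Prime)
  obtain ⟨x, hx⟩ := IsCyclic.exists_generator (α := (ZMod p)ˣ)
  have hcard : (Fintype.card (ZMod p)ˣ : ℤ) = p - 1 := by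
    rw [ZMod.card_units, Nat.cast_sub hp.one_le, Nat.cast_one]
  have hsumone : ∑ i : (ZMod p)ˣ, ∑ j, (1 : Matrix (ZMod p)ˣ (ZMod p)ˣ ℤ) i j = p - 1 := by
    simp only [Matrix.one_apply, Finset.sum_ite_eq, Finset.mem_univ, if_true]
    simp only [Finset.sum_const, Finset.card_univ, nsmul_eq_mul, mul_one]
    exact hcard
  have hsumZ := sum_augmentationRep_translation (p := p)
  let X : MonoidAlgebra ℤ (GA p) := MonoidAlgebra.single (SemidirectProduct.inr x) 1
  let Z : MonoidAlgebra ℤ (GA p) :=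
    MonoidAlgebra.single (SemidirectProduct.inl (Multiplicative.ofAdd 1)) 1
  let S : MonoidAlgebra ℤ (GA p) := ∑ u, MonoidAlgebra.single (SemidirectProduct.inr u) 1
  let φ : GA p →* Matrix (ZMod p)ˣ (ZMod p)ˣ ℤ :=
    (leftRegularMatrix (ZMod p)ˣ).comp SemidirectProduct.rightHom
  have hφ : ∀ u, φ (SemidirectProduct.inr u) = leftRegularMatrix _ u := fun u => by simp [φ]
  have hφZ : φ (SemidirectProduct.inl (Multiplicative.ofAdd 1)) = 1 := by simp [φ]
  rcases hm with hm | ⟨h, rfl⟩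
  · -- The residue `r` of `m` gives the unit part, the quotient `k` corrects the trivial character.
    obtain ⟨r, hr⟩ : ∃ r : ℕ, (r : ℤ) = m % Fintype.card (ZMod p)ˣ :=
      ⟨_, Int.toNat_of_nonneg (Int.emod_nonneg _ (by exact_mod_cast Fintype.card_ne_zero))⟩
    set k := m / Fintype.card (ZMod p)ˣ with hk
    have hmk : (r : ℤ) + k * Fintype.card (ZMod p)ˣ = m := by
      rw [hr, hk, mul_comm]
      exact Int.emod_add_mul_ediv _ _
    have hcop : Nat.Coprime (Fintype.card (ZMod p)ˣ) r := by
      rw [← hcard, ← hmk, Int.gcd_add_mul_right_left, Int.gcd_natCast_natCast] at hm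
      exact Nat.Coprime.symm hm
    refine ⟨∑ i ∈ Finset.range r, X ^ i + k • S + S * (l • (1 - Z)), ?_⟩
    have key : ∀ ψ : GA p →* Matrix (ZMod p)ˣ (ZMod p)ˣ ℤ,
        (∀ u, ψ (SemidirectProduct.inr u) = leftRegularMatrix _ u) →
        (MonoidAlgebra.lift ℤ _ (GA p) ψ
          (∑ i ∈ Finset.range r, X ^ i + k • S + S * (l • (1 - Z)))).det =
          m + l * (p - 1 - ∑ i, ∑ j,
            ψ (SemidirectProduct.inl (Multiplicative.ofAdd 1)) i j) := by
      intro ψ hψ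
      simp only [map_add, map_sum, map_pow, map_smul, map_mul, map_sub, map_one, X, Z,
        MonoidAlgebra.lift_single, one_smul, hψ, show MonoidAlgebra.lift ℤ _ (GA p) ψ S = _ from
          lift_sum_inr ψ hψ]
      rw [det_geom_sum_add x hx r hcop k, hmk]
      simp only [Matrix.smul_apply, Matrix.sub_apply, smul_eq_mul, ← Finset.mul_sum,
        Finset.sum_sub_distrib, hsumone]
    rw [groupDet_affine, key _ augmentationRep_inr, key φ hφ, hsumZ, hφZ, hsumone]
    ring
  · -- The perturbation `-Z S (b + c Z)` has augmentation `h S`, so `c = -h - b`, and the remaining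
    -- freedom in `b` moves the second determinant `p b + h`.
    let b : ℤ := h * (p - 2) + l
    refine ⟨1 - X + -Z * S * (b • 1 + (-h - b) • Z), ?_⟩
    have key : ∀ ψ : GA p →* Matrix (ZMod p)ˣ (ZMod p)ˣ ℤ,
        (∀ u, ψ (SemidirectProduct.inr u) = leftRegularMatrix _ u) →
        (MonoidAlgebra.lift ℤ _ (GA p) ψ (1 - X + -Z * S * (b • 1 + (-h - b) • Z))).det =
          (-∑ i, ∑ j, ψ (SemidirectProduct.inl (Multiplicative.ofAdd 1)) i j) *
          (b * (p - 1) + (-h - b) * ∑ i, ∑ j,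
            ψ (SemidirectProduct.inl (Multiplicative.ofAdd 1)) i j) := by
      intro ψ hψ
      simp only [map_add, map_smul, map_mul, map_sub, map_neg, map_one, X, Z,
        MonoidAlgebra.lift_single, one_smul, hψ, show MonoidAlgebra.lift ℤ _ (GA p) ψ S = _ from
          lift_sum_inr ψ hψ]
      rw [det_one_sub_cycle_add_mul_ones_mul x hx]
      simp only [Matrix.smul_apply, Matrix.add_apply, Matrix.neg_apply, smul_eq_mul,
        ← Finset.mul_sum, Finset.sum_add_distrib, Finset.sum_neg_distrib, hsumone]
    rw [groupDet_affine, key _ augmentationRep_inr, key φ hφ, hsumZ, hφZ, hsumone]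
    have h1 : (-((p : ℤ) - 1)) * (b * (p - 1) + (-h - b) * (p - 1)) = (p - 1) ^ 2 * h := by ring
    have h2 : (- -1 : ℤ) * (b * (p - 1) + (-h - b) * -1) = (p - 1) ^ 2 * h + l * p := by
      simp only [b]
      ring
    rw [h1, h2]
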